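/- Let $\Lambda$ be a finite or countably infinite set and let $P=(P(i,j))_{i,j\in\Lambda}$ be a stochastic matrix, i.e. $P(i,j)\ge 0$ and $\sum_j P(i,j)=1$ for every $i$. Let $\mathcal B=\ell^\infty(\Lambda)$ be the von Neumann algebra of the diagonal operators $x=\sum_j x_j|j\rangle\langle j|$, $(x_j)$ bounded, on $\ell^2(\Lambda)$. Let $\rho^{(0)}=(\rho^{(0)}_j)_{j}$ be a normal state on $\mathcal B$, that is, a probability measure on $\Lambda$ with $\rho^{(0)}(x)=\sum_j\rho^{(0)}_jx_j$, and put $\rho^{(n)}=\rho^{(0)}P^n$. Define transition expectations by $$\mathcal E^{(n)}(x\otimes y)=P_{\rho^{(n)}}\,x\,Py,\qquad (Py)_j=\sum_iP(j,i)y_i,$$ where $P_{\rho^{(n)}}$ is the projection onto $\{j:\rho^{(n)}_j>0\}$, and let $\bar b(n)\in\mathcal B$ be the strong limit, as $k\to\infty$, of $\mathcal E^{(n)}(I\otimes\mathcal E^{(n+1)}(I\otimes\cdots\otimes\mathcal E^{(n+k)}(I\otimes I)))$. Let $\mathcal A$ be the infinite tensor product $\bigotimes_{n\ge0}\mathcal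 B$, realized as the algebra of bounded functions on $\Lambda^{\mathbb Z_+}$ that are measurable for the product $\sigma$-algebra ($\Lambda$ discrete), where $a_0\otimes\cdots\otimes a_n\otimes I\otimes\cdots$ is the function $\omega\mapsto\prod_{k\le n}a_k(\omega_k)$. Let $E_{0]}:\mathcal A\to\mathcal B$ be the unique positive linear map which is continuous along uniformly bounded pointwise convergent sequences (with coordinatewise convergence in $\mathcal B$) and satisfies $$E_{0]}(a_0\otimes\cdots\otimes a_n\otimes I\otimes\cdots)=\mathcal E^{(0)}(a_0\otimes\mathcal E^{(1)}(a_1\otimes\cdots\otimes\mathcal E^{(n)}(a_n\otimes\bar b(n+1)))).$$ The pair $(\rho^{(0)},(\mathcal E^{(n)})_{n\ge0})$ is a (nonhomogeneous) quantum Markov chain (QMC) if the functional $a\mapsto\rho^{(0)}(E_{0]}(a))$ takes the value $1$ at $I\otimes I\otimes\cdots$. It is called reducible if there are a projection $p\in\mathcal B$ with $p\ne0$, $p\neq I$, and $n_0\ge0$ such that $E_{0]}(p_{[n_0}\,a\,p_{[n_0})=E_{0]}(a)$ for all $a\in\mathcal A$, where $p_{[n_0}=I\otimes\cdots\otimes I\otimes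 p\otimes p\otimes\cdots$ with $p$ in every factor from the $n_0$-th on; otherwise it is called irreducible. Proposition. Suppose that the classical Markov chain with transition matrix $P$ is irreducible, i.e. for all $i,j\in\Lambda$ there is an $n\ge 0$ with $P^n(i,j)>0$. Then, for every faithful initial state $\rho^{(0)}$, the pair $(\rho^{(0)},(\mathcal E^{(n)})_{n\ge0})$ is a QMC and it is irreducible. -/

import Mathlib

open scoped ENNReal ComplexOrder Topology
open Filter MeasureTheory ProbabilityTheory

set_option linter.unusedSectionVars false

noncomputable section

namespace ClassicalQMC

/-! ### Classical Markov chains -/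

/-- A stochastic matrix on `S`: nonnegative entries and rows summing to one. -/
structure StochasticMatrix (S : Type*) where
  entry : S → S → ℝ
  nonneg : ∀ i j, 0 ≤ entry i j
  row_sum : ∀ i, HasSum (entry i) 1

variable {S : Type*}

instance : CoeFun (StochasticMatrix S) (fun _ => S → S → ℝ) := ⟨StochasticMatrix.entry⟩

open Classical in
/-- The entries `P ^ n (i, j)` of the powers of `P` (the `n`-step transition probabilities). -/
def StochasticMatrix.nStep (P : StochasticMatrix S) : ℕ → S → S → ℝ
  | 0 => fun i j => if i = j then 1 else 0
  | n + 1 => fun i j => ∑' k, P i k * P.nStep n k j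

/-- `j` is accessible from `i`. -/
def StochasticMatrix.Accessible (P : StochasticMatrix S) (i j : S) : Prop :=
  ∃ n : ℕ, 0 < P.nStep n i j

/-- The classical chain is irreducible: every two states communicate with each other. -/
def StochasticMatrix.IsIrreducible (P : StochasticMatrix S) : Prop :=
  ∀ i j : S, P.Accessible i j ∧ P.Accessible j i

/-- The action of `P` on measures: `(ρ P)_i = ∑ j, ρ_j P(j, i)`, iterated `n` times. -/
def StochasticMatrix.evolve (P : StochasticMatrix S) (ρ : S → ℝ) : ℕ → S → ℝ
  | 0 => ρ
  | n + 1 => fun i => ∑' j, P.evolve ρ n j * P j i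

/-! ### The one-site algebra -/

/-- The one-site von Neumann algebra: the operators `∑ j, x_j |j⟩⟨j|` on `ℓ²(S)` with `(x_j)` a
bounded complex sequence, that is `ℓ^∞(S)` with its pointwise *-algebra structure. -/
abbrev SiteAlg (S : Type*) : Type _ := lp (fun _ : S => ℂ) ∞

/-- A normal state on the one-site algebra, given by its density `∑ j, ρ_j |j⟩⟨j|`. -/
structure NormalState (S : Type*) where
  density : S → ℝ
  nonneg : ∀ j, 0 ≤ density j
  sum_one : HasSum density 1

/-- The value `Tr(ρ x) = ∑ j, ρ_j x_j` of the state at `x`. -/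
def NormalState.eval (ρ : NormalState S) (x : SiteAlg S) : ℂ :=
  ∑' j, (ρ.density j : ℂ) * x j

/-- A state is faithful if it vanishes on no nonzero positive element `x* x`. -/
def NormalState.IsFaithful (ρ : NormalState S) : Prop :=
  ∀ x : SiteAlg S, ρ.eval (star x * x) = 0 → x = 0

lemma norm_coord_le (x : SiteAlg S) (j : S) : ‖x j‖ ≤ ‖x‖ :=
  lp.norm_apply_le_norm ENNReal.top_ne_zero x j

open Classical in
/-- The projection `P_ρ` onto the support `{j | ρ_j > 0}` of a measure `ρ`. -/
def supportProj (ρ : S → ℝ) : SiteAlg S :=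
  ⟨fun j => if 0 < ρ j then 1 else 0, memℓp_infty ⟨1, by
    rintro _ ⟨j, rfl⟩
    dsimp only
    split_ifs <;> simp⟩⟩

lemma StochasticMatrix.summable_mul (P : StochasticMatrix S) (y : SiteAlg S) (j : S) :
    Summable fun i => ‖(P j i : ℂ) * y i‖ := by
  refine Summable.of_nonneg_of_le (fun _ => norm_nonneg _) (fun i => ?_)
    ((P.row_sum j).summable.mul_right ‖y‖)
  rw [norm_mul, Complex.norm_real, Real.norm_of_nonneg (P.nonneg j i)]
  exact mul_le_mul_of_nonneg_left (norm_coord_le y i) (P.nonneg j i)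

/-- The action of `P` on observables: `(P y)_j = ∑ i, P(j, i) y_i`. -/
def StochasticMatrix.act (P : StochasticMatrix S) (y : SiteAlg S) : SiteAlg S :=
  ⟨fun j => ∑' i, (P j i : ℂ) * y i, memℓp_infty ⟨‖y‖, by
    rintro _ ⟨j, rfl⟩
    refine (norm_tsum_le_tsum_norm (P.summable_mul y j)).trans ?_
    have h : HasSum (fun i => P j i * ‖y‖) (1 * ‖y‖) := (P.row_sum j).mul_right _
    rw [one_mul] at h
    rw [← h.tsum_eq]
    refine Summable.tsum_le_tsum (fun i => ?_) (P.summable_mul y j) h.summable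
    rw [norm_mul, Complex.norm_real, Real.norm_of_nonneg (P.nonneg j i)]
    exact mul_le_mul_of_nonneg_left (norm_coord_le y i) (P.nonneg j i)⟩⟩

/-! ### Transition expectations -/

/-- The transition expectation at time `n`, evaluated at elementary tensors:
`ℰ⁽ⁿ⁾(x ⊗ y) = P_{ρ⁽ⁿ⁾} x P y` with `ρ⁽ⁿ⁾ = ρ Pⁿ`. -/
def transExp (P : StochasticMatrix S) (ρ : S → ℝ) (n : ℕ) (x y : SiteAlg S) : SiteAlg S :=
  supportProj (P.evolve ρ n) * x * P.act y

/-- `nest ℰ a y m k = ℰ⁽ᵐ⁾(a_m ⊗ ℰ⁽ᵐ⁺¹⁾(a_{m+1} ⊗ ⋯ ⊗ ℰ⁽ᵐ⁺ᵏ⁾(a_{m+k} ⊗ y)))`. -/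
def nest (ℰ : ℕ → SiteAlg S → SiteAlg S → SiteAlg S) (a : ℕ → SiteAlg S) (y : SiteAlg S) :
    ℕ → ℕ → SiteAlg S
  | m, 0 => ℰ m (a m) y
  | m, k + 1 => ℰ m (a m) (nest ℰ a y (m + 1) k)

lemma nest_succ_right (ℰ : ℕ → SiteAlg S → SiteAlg S → SiteAlg S) (a : ℕ → SiteAlg S)
    (y : SiteAlg S) (m k : ℕ) :
    nest ℰ a y m (k + 1) = nest ℰ a (ℰ (m + k + 1) (a (m + k + 1)) y) m k := by
  induction k generalizing m with
  | zero => rfl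
  | succ k ih =>
    rw [nest, ih, nest]
    congr 3 <;> (try congr 1) <;> omega

lemma nest_congr (ℰ : ℕ → SiteAlg S → SiteAlg S → SiteAlg S) {a b : ℕ → SiteAlg S}
    (y : SiteAlg S) (m k : ℕ) (h : ∀ l, m ≤ l → l ≤ m + k → a l = b l) :
    nest ℰ a y m k = nest ℰ b y m k := by
  induction k generalizing m with
  | zero => simp only [nest]; rw [h m le_rfl (by omega)]
  | succ k ih =>
    simp only [nest]
    rw [h m le_rfl (by omega), ih (m + 1) fun l h1 h2 => h l (by omega) (by omega)]

lemma nest_nest (ℰ : ℕ → SiteAlg S → SiteAlg S → SiteAlg S) (a : ℕ → SiteAlg S)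
    (y : SiteAlg S) (m n k : ℕ) :
    nest ℰ a (nest ℰ a y (m + n + 1) k) m n = nest ℰ a y m (n + k + 1) := by
  induction n generalizing m with
  | zero => simp [nest]
  | succ n ih =>
    rw [nest, show m + (n + 1) + 1 = (m + 1) + n + 1 by omega, ih,
      show n + 1 + k + 1 = (n + k + 1) + 1 by omega]
    rfl

/-! ### The algebra over the half-line -/

section HalfLine

variable [MeasurableSpace S]

/-- The algebra over `ℤ₊`: the bounded functions on `S^ℤ₊` that are measurable for the product
σ-algebra.  It is the closure of the union of the local algebras `ℓ^∞(S^{n+1})` under bounded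
pointwise limits of sequences. -/
def HalfLineAlg (S : Type*) [MeasurableSpace S] :
    StarSubalgebra ℂ (lp (fun _ : ℕ → S => ℂ) ∞) where
  carrier := {f | Measurable fun ω => f ω}
  mul_mem' {f g} hf hg := by
    have : (fun ω => (f * g) ω) = fun ω => f ω * g ω := by
      funext ω; rw [lp.infty_coeFn_mul]; rfl
    simp only [Set.mem_ofPred_eq, this] at *
    exact hf.mul hg
  add_mem' {f g} hf hg := by
    have : (fun ω => (f + g) ω) = fun ω => f ω + g ω := by
      funext ω; rw [lp.coeFn_add]; rfl
    simp only [Set.mem_ofPred_eq, this] at *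
    exact hf.add hg
  algebraMap_mem' c := by
    have : (fun ω => (algebraMap ℂ (lp (fun _ : ℕ → S => ℂ) ∞) c) ω) = fun _ => c := rfl
    simp only [Set.mem_ofPred_eq, this]
    exact measurable_const
  star_mem' {f} hf := by
    have : (fun ω => (star f) ω) = fun ω => star (f ω) := by
      funext ω; rw [lp.coeFn_star]; rfl
    simp only [Set.mem_ofPred_eq, this] at *
    exact continuous_star.measurable.comp hf

instance : CoeFun (HalfLineAlg S) (fun _ => (ℕ → S) → ℂ) := ⟨fun f => f.1⟩

lemma HalfLineAlg.measurable_apply (f : HalfLineAlg S) : Measurable (fun ω => f ω) := f.2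

/-- The element of the algebra over `ℤ₊` given by a bounded measurable function. -/
def HalfLineAlg.mk (f : (ℕ → S) → ℂ) (hf : Measurable f) (C : ℝ) (hC : ∀ ω, ‖f ω‖ ≤ C) :
    HalfLineAlg S :=
  ⟨⟨f, memℓp_infty ⟨C, by rintro _ ⟨ω, rfl⟩; exact hC ω⟩⟩, hf⟩

variable [DiscreteMeasurableSpace S]

/-- The embedding `J_n` of the one-site algebra as the `n`-th tensor factor. -/
def embed (n : ℕ) (x : SiteAlg S) : HalfLineAlg S :=
  HalfLineAlg.mk (fun ω => x (ω n))
    ((Measurable.of_discrete (f := fun j => x j)).comp (measurable_pi_apply n)) ‖x‖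
    (fun _ => norm_coord_le x _)

/-- `a_0 ⊗ a_1 ⊗ ⋯ ⊗ a_n ⊗ I ⊗ I ⊗ ⋯`, that is `J_0(a_0) J_1(a_1) ⋯ J_n(a_n)`. -/
def tensor (a : ℕ → SiteAlg S) (n : ℕ) : HalfLineAlg S :=
  ∏ k ∈ Finset.range (n + 1), embed k (a k)

open Classical in
/-- For a projection `p` of the one-site algebra, the projection
`p_{[n} = I ⊗ ⋯ ⊗ I ⊗ p ⊗ p ⊗ ⋯` (with `p` in all factors from the `n`-th on). -/
def tailProj (p : SiteAlg S) (n : ℕ) : HalfLineAlg S :=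
  HalfLineAlg.mk (fun ω => if ∀ k, n ≤ k → p (ω k) = 1 then 1 else 0)
    (by
      refine Measurable.ite ?_ measurable_const measurable_const
      have : {ω : ℕ → S | ∀ k, n ≤ k → p (ω k) = 1} =
          ⋂ k, {ω | n ≤ k → p (ω k) = 1} := by ext; simp
      rw [this]
      refine MeasurableSet.iInter fun k => ?_
      exact (MeasurableSet.of_discrete (s := {j : S | n ≤ k → p j = 1})).preimage
        (measurable_pi_apply k))
    1 (fun ω => by split_ifs <;> simp)

lemma embed_apply (n : ℕ) (x : SiteAlg S) (ω : ℕ → S) : embed n x ω = x (ω n) := rfl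

lemma HalfLineAlg.mul_apply (f g : HalfLineAlg S) (ω : ℕ → S) : (f * g) ω = f ω * g ω := by
  change ((f.1 * g.1 : lp (fun _ : ℕ → S => ℂ) ∞)) ω = _
  rw [lp.infty_coeFn_mul]; rfl

lemma HalfLineAlg.prod_apply (s : Finset ℕ) (f : ℕ → HalfLineAlg S) (ω : ℕ → S) :
    (∏ k ∈ s, f k) ω = ∏ k ∈ s, f k ω := by
  classical
  induction s using Finset.induction_on with
  | empty => rfl
  | insert a s ha ih => rw [Finset.prod_insert ha, Finset.prod_insert ha, mul_apply, ih]

lemma tensor_apply (a : ℕ → SiteAlg S) (n : ℕ) (ω : ℕ → S) :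
    tensor a n ω = ∏ k ∈ Finset.range (n + 1), a k (ω k) := by
  rw [tensor, HalfLineAlg.prod_apply]; rfl

lemma proj_zero_or_one {p : SiteAlg S} (hp : IsStarProjection p) (j : S) : p j = 0 ∨ p j = 1 := by
  have h : (p * p : SiteAlg S) j = p j := by rw [hp.isIdempotentElem.eq]
  rw [lp.infty_coeFn_mul] at h
  have h' : p j * (p j - 1) = 0 := by
    have : p j * p j = p j := h
    rw [mul_sub, this]; ring
  rcases mul_eq_zero.1 h' with h0 | h1
  · exact Or.inl h0
  · exact Or.inr (sub_eq_zero.1 h1)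

/-- `p_{[n}` is the limit of the projections `I ⊗ ⋯ ⊗ I ⊗ p ⊗ ⋯ ⊗ p ⊗ I ⊗ ⋯` (with `p` in the
factors from `n` to `m - 1`) as `m → ∞`. -/
lemma tendsto_tailProj {p : SiteAlg S} (hp : IsStarProjection p) (n : ℕ) (ω : ℕ → S) :
    Tendsto (fun m => (∏ k ∈ Finset.Ico n m, embed k p) ω) atTop (𝓝 (tailProj p n ω)) := by
  classical
  have ht : tailProj p n ω = if ∀ k, n ≤ k → p (ω k) = 1 then 1 else 0 := rfl
  refine tendsto_const_nhds.congr' ?_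
  simp only [HalfLineAlg.prod_apply, embed_apply, ht]
  split_ifs with h
  · refine Eventually.of_forall fun m => ?_
    exact (Finset.prod_eq_one fun k hk => h k (Finset.mem_Ico.1 hk).1).symm
  · push Not at h
    obtain ⟨k, hk, hpk⟩ := h
    filter_upwards [eventually_gt_atTop k] with m hm
    exact (Finset.prod_eq_zero (Finset.mem_Ico.2 ⟨hk, hm⟩)
      ((proj_zero_or_one hp _).resolve_right hpk)).symm

end HalfLine

/-! ### The path measure (auxiliary, used only for the existence of the forward map) -/

section Path

variable [MeasurableSpace S] [DiscreteMeasurableSpace S]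

/-- The row `P(i, ·)` as a probability distribution. -/
def StochasticMatrix.row (P : StochasticMatrix S) (i : S) : PMF S :=
  ⟨fun j => ENNReal.ofReal (P i j), by
    have h := P.row_sum i
    have h2 : ∑' j, ENNReal.ofReal (P i j) = 1 := by
      rw [← ENNReal.ofReal_tsum_of_nonneg (P.nonneg i) h.summable, h.tsum_eq, ENNReal.ofReal_one]
    rw [← h2]
    exact ENNReal.summable.hasSum⟩

/-- The one-step kernels. -/
def stepKernel (P : StochasticMatrix S) (n : ℕ) : Kernel (Π _ : Finset.Iic n, S) S where
  toFun h := (P.row (h ⟨n, by simp⟩)).toMeasure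
  measurable' := by
    have : Measurable fun i : S => (P.row i).toMeasure := Measurable.of_discrete
    exact this.comp (measurable_pi_apply _)

instance (P : StochasticMatrix S) (n : ℕ) : IsMarkovKernel (stepKernel P n) :=
  ⟨fun h => by
    change IsProbabilityMeasure (P.row _).toMeasure
    infer_instance⟩

/-- The law of the classical chain started at `j`. -/
def pathMeasure (P : StochasticMatrix S) (j : S) : Measure (ℕ → S) :=
  Kernel.traj (X := fun _ => S) (stepKernel P) 0 (fun _ => j)

instance (P : StochasticMatrix S) (j : S) : IsProbabilityMeasure (pathMeasure P j) := by
  unfold pathMeasure; infer_instance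

lemma integral_row (P : StochasticMatrix S) (y : SiteAlg S) (i : S) :
    ∫ k, y k ∂(P.row i).toMeasure = P.act y i := by
  have hm : AEStronglyMeasurable (fun k => y k) (P.row i).toMeasure :=
    (Measurable.of_discrete (f := fun k => y k)).aestronglyMeasurable
  rw [PMF.integral_eq_tsum _ _
    (Integrable.of_bound hm ‖y‖ (Eventually.of_forall fun k => norm_coord_le y k))]
  change _ = ∑' k, (P i k : ℂ) * y k
  refine tsum_congr fun k => ?_
  change (ENNReal.ofReal (P i k)).toReal • y k = _
  rw [ENNReal.toReal_ofReal (P.nonneg i k), Complex.real_smul]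

lemma integral_zero_coord (P : StochasticMatrix S) (y : SiteAlg S) (j : S) :
    ∫ ω, y (ω 0) ∂pathMeasure P j = y j := by
  have h := Kernel.traj_map_frestrictLe_apply (X := fun _ => S) (κ := stepKernel P) 0 0
    (fun _ => j)
  rw [Kernel.partialTraj_self, Kernel.id_apply] at h
  have hg : Measurable fun h : (Π _ : Finset.Iic 0, S) => y (h ⟨0, by simp⟩) :=
    (Measurable.of_discrete (f := fun k => y k)).comp (measurable_pi_apply _)
  have h2 : ∫ ω, y (ω 0) ∂pathMeasure P j =
      ∫ h, y (h ⟨0, by simp⟩) ∂((pathMeasure P j).map (Preorder.frestrictLe 0)) := by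
    rw [integral_map (by fun_prop) hg.aestronglyMeasurable]; rfl
  rw [h2, pathMeasure, h, integral_dirac' _ _ hg.stronglyMeasurable]

/-- The Markov property. -/
lemma integral_markov (P : StochasticMatrix S) (j : S) (n : ℕ)
    (G : (Π _ : Finset.Iic n, S) → ℂ) (hG : Measurable G) (C : ℝ) (hC : ∀ h, ‖G h‖ ≤ C)
    (y : SiteAlg S) :
    ∫ ω, G (Preorder.frestrictLe n ω) * y (ω (n + 1)) ∂pathMeasure P j =
      ∫ ω, G (Preorder.frestrictLe n ω) * P.act y (ω n) ∂pathMeasure P j := by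
  have hy : Measurable fun k => y k := Measurable.of_discrete
  have h1 := Kernel.partialTraj_compProd_eq_map_traj (X := fun _ => S) (κ := stepKernel P)
    (Nat.zero_le n) (x₀ := fun _ => j)
  have h3 := Kernel.traj_map_frestrictLe_apply (X := fun _ => S) (κ := stepKernel P) 0 n
    (fun _ => j)
  have hF : Measurable fun z : (Π _ : Finset.Iic n, S) × S => G z.1 * y z.2 :=
    (hG.comp measurable_fst).mul (hy.comp measurable_snd)
  have hF2 : Measurable fun h : (Π _ : Finset.Iic n, S) => G h * P.act y (h ⟨n, by simp⟩) :=
    hG.mul ((Measurable.of_discrete (f := fun k => P.act y k)).comp (measurable_pi_apply _))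
  have e1 : ∫ ω, G (Preorder.frestrictLe n ω) * y (ω (n + 1)) ∂pathMeasure P j =
      ∫ z, G z.1 * y z.2 ∂((pathMeasure P j).map
        (fun x => (Preorder.frestrictLe n x, x (n + 1)))) := by
    rw [integral_map (by fun_prop) hF.aestronglyMeasurable]
  have e2 : ∫ ω, G (Preorder.frestrictLe n ω) * P.act y (ω n) ∂pathMeasure P j =
      ∫ h, G h * P.act y (h ⟨n, by simp⟩) ∂((pathMeasure P j).map (Preorder.frestrictLe n)) := by
    rw [integral_map (by fun_prop) hF2.aestronglyMeasurable]; rfl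
  rw [e1, e2, pathMeasure, h3, ← h1, Measure.integral_compProd]
  · refine integral_congr_ae (Eventually.of_forall fun h => ?_)
    dsimp only
    rw [integral_const_mul, ← integral_row]
    rfl
  · refine Integrable.of_bound hF.aestronglyMeasurable (C * ‖y‖) (Eventually.of_forall fun z => ?_)
    rw [norm_mul]
    exact mul_le_mul (hC _) (norm_coord_le _ _) (norm_nonneg _) ((norm_nonneg _).trans (hC z.1))

lemma transExp_apply (P : StochasticMatrix S) (ρ : S → ℝ) (n : ℕ) (x y : SiteAlg S) (j : S) :
    transExp P ρ n x y j = supportProj (P.evolve ρ n) j * x j * P.act y j := by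
  rw [transExp, lp.infty_coeFn_mul, Pi.mul_apply, lp.infty_coeFn_mul, Pi.mul_apply]

lemma norm_supportProj_le (ρ : S → ℝ) (j : S) : ‖supportProj ρ j‖ ≤ 1 := by
  classical
  change ‖(if 0 < ρ j then 1 else 0 : ℂ)‖ ≤ 1
  split_ifs <;> simp

/-- The weight of the factors `m, …, m + k` along a path. -/
def weight (P : StochasticMatrix S) (ρ : S → ℝ) (a : ℕ → SiteAlg S) (m k : ℕ) (ω : ℕ → S) : ℂ :=
  ∏ l ∈ Finset.range k, (supportProj (P.evolve ρ (m + l)) (ω l) * a (m + l) (ω l))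

lemma weight_measurable (P : StochasticMatrix S) (ρ : S → ℝ) (a : ℕ → SiteAlg S) (m k : ℕ) :
    Measurable (weight P ρ a m k) := by
  unfold weight
  refine Finset.measurable_prod _ fun l _ => ?_
  exact (Measurable.of_discrete
    (f := fun i => supportProj (P.evolve ρ (m + l)) i * a (m + l) i)).comp (measurable_pi_apply l)

lemma weight_bound (P : StochasticMatrix S) (ρ : S → ℝ) (a : ℕ → SiteAlg S) (m k : ℕ)
    (ω : ℕ → S) : ‖weight P ρ a m k ω‖ ≤ ∏ l ∈ Finset.range k, ‖a (m + l)‖ := by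
  unfold weight
  rw [norm_prod]
  refine Finset.prod_le_prod (fun _ _ => norm_nonneg _) fun l _ => ?_
  rw [norm_mul, ← one_mul ‖a (m + l)‖]
  exact mul_le_mul (norm_supportProj_le _ _) (norm_coord_le _ _) (norm_nonneg _) zero_le_one

lemma nest_eq_integral (P : StochasticMatrix S) (ρ : S → ℝ) (a : ℕ → SiteAlg S)
    (y : SiteAlg S) (m k : ℕ) (j : S) :
    nest (transExp P ρ) a y m k j =
      ∫ ω, weight P ρ a m (k + 1) ω * y (ω (k + 1)) ∂pathMeasure P j := by
  -- the Markov property applied to the last factor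
  have key : ∀ (k : ℕ) (y : SiteAlg S),
      ∫ ω, weight P ρ a m (k + 1) ω * y (ω (k + 1)) ∂pathMeasure P j =
      ∫ ω, weight P ρ a m k ω * transExp P ρ (m + k) (a (m + k)) y (ω k) ∂pathMeasure P j := by
    intro k y
    let G : (Π _ : Finset.Iic k, S) → ℂ := fun h =>
      ∏ l ∈ (Finset.range (k + 1)).attach,
        (supportProj (P.evolve ρ (m + l.1))
            (h ⟨l.1, Finset.mem_Iic.2 (Nat.lt_succ_iff.1 (Finset.mem_range.1 l.2))⟩) *
          a (m + l.1) (h ⟨l.1, Finset.mem_Iic.2 (Nat.lt_succ_iff.1 (Finset.mem_range.1 l.2))⟩))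
    have hGw : ∀ ω : ℕ → S, weight P ρ a m (k + 1) ω = G (Preorder.frestrictLe k ω) := by
      intro ω
      unfold weight
      rw [← Finset.prod_attach]
      rfl
    have hG : Measurable G := by
      refine Finset.measurable_prod _ fun l _ => ?_
      exact (Measurable.of_discrete
        (f := fun i => supportProj (P.evolve ρ (m + l.1)) i * a (m + l.1) i)).comp
        (measurable_pi_apply _)
    have hC : ∀ h, ‖G h‖ ≤ ∏ l ∈ (Finset.range (k + 1)).attach, ‖a (m + l.1)‖ := by
      intro h
      rw [norm_prod]
      refine Finset.prod_le_prod (fun _ _ => norm_nonneg _) fun l _ => ?_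
      rw [norm_mul, ← one_mul ‖a (m + l.1)‖]
      exact mul_le_mul (norm_supportProj_le _ _) (norm_coord_le _ _) (norm_nonneg _) zero_le_one
    have h := integral_markov P j k G hG _ hC y
    simp only [← hGw] at h
    rw [h]
    refine integral_congr_ae (Eventually.of_forall fun ω => ?_)
    simp only [transExp_apply, weight, Finset.prod_range_succ]
    ring
  induction k generalizing y with
  | zero =>
    rw [key 0 y]
    simp only [weight, Finset.prod_range_zero, one_mul, Nat.add_zero]
    rw [integral_zero_coord]
    rfl
  | succ k ih =>
    rw [nest_succ_right, ih, key (k + 1) y]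
    rfl

lemma norm_pathIntegral_le (P : StochasticMatrix S) (j : S) (f : (ℕ → S) → ℂ) (C : ℝ)
    (hC : ∀ ω, ‖f ω‖ ≤ C) : ‖∫ ω, f ω ∂pathMeasure P j‖ ≤ C := by
  have := norm_integral_le_of_norm_le_const (μ := pathMeasure P j) (Eventually.of_forall hC)
  simpa using this

lemma nest_one_bound (P : StochasticMatrix S) (ρ : S → ℝ) (m k : ℕ) (j : S) :
    ‖nest (transExp P ρ) 1 1 m k j‖ ≤ 1 := by
  have : Nonempty S := ⟨j⟩
  rw [nest_eq_integral]
  refine norm_pathIntegral_le _ _ _ _ fun ω => ?_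
  have h := weight_bound P ρ 1 m (k + 1) ω
  simp only [Pi.one_apply, norm_one, Finset.prod_const_one] at h
  rw [norm_mul, ← one_mul (1 : ℝ)]
  refine mul_le_mul h ?_ (norm_nonneg _) zero_le_one
  exact (norm_coord_le _ _).trans norm_one.le

open Classical in
/-- The indicator of the paths that stay in the supports of `ρ⁽⁰⁾, ρ⁽¹⁾, …` shifted by `m`. -/
def stay (P : StochasticMatrix S) (ρ : S → ℝ) (m : ℕ) (ω : ℕ → S) : ℂ :=
  if ∀ l, 0 < P.evolve ρ (m + l) (ω l) then 1 else 0

lemma norm_stay_le (P : StochasticMatrix S) (ρ : S → ℝ) (m : ℕ) (ω : ℕ → S) :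
    ‖stay P ρ m ω‖ ≤ 1 := by
  unfold stay; split_ifs <;> simp

lemma tendsto_weight_one (P : StochasticMatrix S) (ρ : S → ℝ) (m : ℕ) (ω : ℕ → S) :
    Tendsto (fun k => ∏ l ∈ Finset.range k, supportProj (P.evolve ρ (m + l)) (ω l)) atTop
      (𝓝 (stay P ρ m ω)) := by
  classical
  have hs : ∀ l, supportProj (P.evolve ρ (m + l)) (ω l) =
      if 0 < P.evolve ρ (m + l) (ω l) then 1 else 0 := by
    intro l; simp only [supportProj]
  refine tendsto_const_nhds.congr' ?_
  by_cases h : ∀ l, 0 < P.evolve ρ (m + l) (ω l)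
  · refine Eventually.of_forall fun k => ?_
    rw [stay, if_pos h]
    exact (Finset.prod_eq_one fun l _ => by rw [hs, if_pos (h l)]).symm
  · rw [stay, if_neg h]
    obtain ⟨l, hl⟩ := not_forall.1 h
    filter_upwards [eventually_gt_atTop l] with k hk
    exact (Finset.prod_eq_zero (Finset.mem_range.2 hk) (by rw [hs, if_neg hl])).symm

lemma stay_measurable (P : StochasticMatrix S) (ρ : S → ℝ) (m : ℕ) :
    Measurable (stay P ρ m) := by
  refine measurable_of_tendsto_metrizable (fun k => ?_)
    (tendsto_pi_nhds.2 fun ω => tendsto_weight_one P ρ m ω)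
  refine Finset.measurable_prod _ fun l _ => ?_
  exact (Measurable.of_discrete
    (f := fun i => supportProj (P.evolve ρ (m + l)) i)).comp (measurable_pi_apply l)

lemma tendsto_nest_one (P : StochasticMatrix S) (ρ : S → ℝ) (a : ℕ → SiteAlg S) (m n : ℕ)
    (ha : ∀ l, n < l → a (m + l) = 1) (j : S) :
    Tendsto (fun k => nest (transExp P ρ) a 1 m (n + k) j) atTop
      (𝓝 (∫ ω, stay P ρ m ω * ∏ l ∈ Finset.range (n + 1), a (m + l) (ω l) ∂pathMeasure P j)) := by
  have : Nonempty S := ⟨j⟩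
  have hw : ∀ k ω, weight P ρ a m (n + k + 1) ω * (1 : SiteAlg S) (ω (n + k + 1)) =
      (∏ l ∈ Finset.range (k + (n + 1)), supportProj (P.evolve ρ (m + l)) (ω l)) *
        ∏ l ∈ Finset.range (n + 1), a (m + l) (ω l) := by
    intro k ω
    have h1 : ∀ i : S, (1 : SiteAlg S) i = 1 := fun i => by rw [lp.infty_coeFn_one]; rfl
    rw [h1, mul_one, weight, Finset.prod_mul_distrib, show n + k + 1 = k + (n + 1) by omega]
    congr 1
    refine (Finset.prod_subset (fun l hl => ?_) fun l _ hl => ?_).symm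
    · rw [Finset.mem_range] at hl ⊢; omega
    · rw [Finset.mem_range] at hl
      rw [ha l (by omega), h1]
  simp only [nest_eq_integral]
  refine tendsto_integral_of_dominated_convergence
    (fun _ => ∏ l ∈ Finset.range (n + 1), ‖a (m + l)‖) (fun k => ?_) (integrable_const _)
    (fun k => Eventually.of_forall fun ω => ?_) (Eventually.of_forall fun ω => ?_)
  · refine Measurable.aestronglyMeasurable ((weight_measurable P ρ a m _).mul ?_)
    exact (Measurable.of_discrete (f := fun i => (1 : SiteAlg S) i)).comp (measurable_pi_apply _)
  · rw [hw, norm_mul, norm_prod, norm_prod, ← one_mul (∏ l ∈ Finset.range (n + 1), ‖a (m + l)‖)]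
    refine mul_le_mul ?_ ?_ (Finset.prod_nonneg fun _ _ => norm_nonneg _) zero_le_one
    · exact Finset.prod_le_one (fun _ _ => norm_nonneg _) fun _ _ => norm_supportProj_le _ _
    · exact Finset.prod_le_prod (fun _ _ => norm_nonneg _) fun _ _ => norm_coord_le _ _
  · simp only [hw]
    exact ((tendsto_weight_one P ρ m ω).comp (tendsto_add_atTop_nat (n + 1))).mul_const _

/-- Existence of the limit
`b(n) = lim_k ℰ⁽ⁿ⁾(I ⊗ ℰ⁽ⁿ⁺¹⁾(I ⊗ ⋯ ⊗ ℰ⁽ⁿ⁺ᵏ⁾(I ⊗ I)))` in the strong topology; for a bounded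
sequence of diagonal operators this is convergence of every coordinate. -/
lemma exists_bbar (P : StochasticMatrix S) (ρ : S → ℝ) (n : ℕ) :
    ∃ b : SiteAlg S, ∀ j,
      Tendsto (fun k => nest (transExp P ρ) 1 1 n k j) atTop (𝓝 (b j)) := by
  have h := fun j => tendsto_nest_one P ρ 1 n 0 (fun _ _ => rfl) j
  simp only [zero_add] at h
  exact ⟨⟨_, memℓp_infty ⟨1, by
    rintro _ ⟨j, rfl⟩
    exact le_of_tendsto (h j).norm (Eventually.of_forall fun k => nest_one_bound P ρ n k j)⟩⟩, h⟩

end Path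

/-! ### The quantum Markov chain -/

section QMC

variable [MeasurableSpace S] [DiscreteMeasurableSpace S]

/-- The element `b(n) = lim_k ℰ⁽ⁿ⁾(I ⊗ ℰ⁽ⁿ⁺¹⁾(I ⊗ ⋯ ⊗ ℰ⁽ⁿ⁺ᵏ⁾(I ⊗ I)))`. -/
def bbar (P : StochasticMatrix S) (ρ : S → ℝ) (n : ℕ) : SiteAlg S :=
  Classical.choose (exists_bbar P ρ n)

lemma bbar_spec (P : StochasticMatrix S) (ρ : S → ℝ) (n : ℕ) (j : S) :
    Tendsto (fun k => nest (transExp P ρ) 1 1 n k j) atTop (𝓝 (bbar P ρ n j)) :=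
  Classical.choose_spec (exists_bbar P ρ n) j

/-- The properties that determine `E_{0]}`: it is linear and positive, it has the prescribed values
`E_{0]}(a_0 ⊗ ⋯ ⊗ a_n ⊗ I ⊗ ⋯) = ℰ⁽⁰⁾(a_0 ⊗ ℰ⁽¹⁾(a_1 ⊗ ⋯ ⊗ ℰ⁽ⁿ⁾(a_n ⊗ b(n+1))))`, and it is
normal, i.e. continuous along bounded pointwise convergent sequences. -/
structure IsForwardMap (P : StochasticMatrix S) (ρ : S → ℝ)
    (E : HalfLineAlg S →ₗ[ℂ] SiteAlg S) : Prop where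
  map_tensor : ∀ (a : ℕ → SiteAlg S) (n : ℕ),
    E (tensor a n) = nest (transExp P ρ) a (bbar P ρ (n + 1)) 0 n
  nonneg : ∀ f : HalfLineAlg S, (∀ ω, 0 ≤ f ω) → ∀ j, 0 ≤ E f j
  normal : ∀ (f : ℕ → HalfLineAlg S) (g : HalfLineAlg S) (C : ℝ), (∀ k ω, ‖f k ω‖ ≤ C) →
    (∀ ω, Tendsto (fun k => f k ω) atTop (𝓝 (g ω))) →
    ∀ j, Tendsto (fun k => E (f k) j) atTop (𝓝 (E g j))

lemma HalfLineAlg.norm_apply_le (f : HalfLineAlg S) (ω : ℕ → S) : ‖f ω‖ ≤ ‖f.1‖ :=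
  lp.norm_apply_le_norm ENNReal.top_ne_zero f.1 ω

lemma stay_mul_integrable (P : StochasticMatrix S) (ρ : S → ℝ) (f : HalfLineAlg S) (j : S) :
    Integrable (fun ω => stay P ρ 0 ω * f ω) (pathMeasure P j) := by
  refine Integrable.of_bound
    ((stay_measurable P ρ 0).mul (HalfLineAlg.measurable_apply f)).aestronglyMeasurable ‖f.1‖
    (Eventually.of_forall fun ω => ?_)
  rw [norm_mul, ← one_mul ‖f.1‖]
  exact mul_le_mul (norm_stay_le _ _ _ _) (HalfLineAlg.norm_apply_le f ω) (norm_nonneg _) zero_le_one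

lemma nest_bbar (P : StochasticMatrix S) (ρ : S → ℝ) (a : ℕ → SiteAlg S) (n : ℕ) (j : S) :
    nest (transExp P ρ) a (bbar P ρ (n + 1)) 0 n j =
      ∫ ω, stay P ρ 0 ω * ∏ l ∈ Finset.range (n + 1), a l (ω l) ∂pathMeasure P j := by
  have : Nonempty S := ⟨j⟩
  let c : ℕ → SiteAlg S := fun l => if l ≤ n then a l else 1
  have hc1 : ∀ l, l ≤ n → c l = a l := fun l hl => if_pos hl
  have hc2 : ∀ l, n < l → c l = 1 := fun l hl => if_neg (by omega)
  have hn : ∀ k, nest (transExp P ρ) a (nest (transExp P ρ) 1 1 (n + 1) k) 0 n =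
      nest (transExp P ρ) c 1 0 (n + (k + 1)) := by
    intro k
    rw [← add_assoc, ← nest_nest, zero_add]
    rw [nest_congr (a := 1) (b := c) _ 1 (n + 1) k fun l h1 _ => (hc2 l (by omega)).symm]
    exact nest_congr _ _ _ _ fun l _ h2 => (hc1 l (by omega)).symm
  have t1 := (tendsto_nest_one P ρ c 0 n (fun l hl => hc2 _ (by omega)) j).comp
    (tendsto_add_atTop_nat 1)
  have t2 : Tendsto
      (fun k => nest (transExp P ρ) a (nest (transExp P ρ) 1 1 (n + 1) k) 0 n j) atTop
      (𝓝 (nest (transExp P ρ) a (bbar P ρ (n + 1)) 0 n j)) := by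
    simp only [nest_eq_integral P ρ a]
    refine tendsto_integral_of_dominated_convergence
      (fun _ => ∏ l ∈ Finset.range (n + 1), ‖a (0 + l)‖) (fun k => ?_) (integrable_const _)
      (fun k => Eventually.of_forall fun ω => ?_) (Eventually.of_forall fun ω => ?_)
    · refine Measurable.aestronglyMeasurable ((weight_measurable P ρ a 0 _).mul ?_)
      exact (Measurable.of_discrete (f := fun i => nest (transExp P ρ) 1 1 (n + 1) k i)).comp
        (measurable_pi_apply _)
    · rw [norm_mul, ← mul_one (∏ l ∈ Finset.range (n + 1), ‖a (0 + l)‖)]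
      exact mul_le_mul (weight_bound _ _ _ _ _ _) (nest_one_bound _ _ _ _ _) (norm_nonneg _)
        (Finset.prod_nonneg fun _ _ => norm_nonneg _)
    · exact (bbar_spec P ρ (n + 1) (ω (n + 1))).const_mul _
  simp only [hn] at t2
  rw [tendsto_nhds_unique t2 t1]
  refine integral_congr_ae (Eventually.of_forall fun ω => ?_)
  dsimp only
  congr 1
  refine Finset.prod_congr rfl fun l hl => ?_
  rw [zero_add, hc1 l (by rw [Finset.mem_range] at hl; omega)]

lemma exists_forwardMap (P : StochasticMatrix S) (ρ : S → ℝ) :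
    ∃ E : HalfLineAlg S →ₗ[ℂ] SiteAlg S, IsForwardMap P ρ E := by
  let E : HalfLineAlg S →ₗ[ℂ] SiteAlg S :=
    { toFun := fun f => ⟨fun j => ∫ ω, stay P ρ 0 ω * f ω ∂pathMeasure P j,
        memℓp_infty ⟨‖f.1‖, by
          rintro _ ⟨j, rfl⟩
          refine norm_pathIntegral_le _ _ _ _ fun ω => ?_
          rw [norm_mul, ← one_mul ‖f.1‖]
          exact mul_le_mul (norm_stay_le _ _ _ _) (HalfLineAlg.norm_apply_le f ω) (norm_nonneg _)
            zero_le_one⟩⟩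
      map_add' := fun f g => by
        ext j
        change ∫ ω, stay P ρ 0 ω * (f ω + g ω) ∂pathMeasure P j = _
        simp only [mul_add]
        exact integral_add (stay_mul_integrable P ρ f j) (stay_mul_integrable P ρ g j)
      map_smul' := fun c f => by
        ext j
        change ∫ ω, stay P ρ 0 ω * (c * f ω) ∂pathMeasure P j =
          c * ∫ ω, stay P ρ 0 ω * f ω ∂pathMeasure P j
        rw [← integral_const_mul]
        refine integral_congr_ae (Eventually.of_forall fun ω => ?_)
        dsimp only
        ring }
  have hE : ∀ f j, E f j = ∫ ω, stay P ρ 0 ω * f ω ∂pathMeasure P j := fun _ _ => rfl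
  refine ⟨E, ⟨fun a n => ?_, fun f hf j => ?_, fun f g C hC hfg j => ?_⟩⟩
  · ext j
    rw [hE, nest_bbar]
    simp only [tensor_apply]
  · rw [hE]
    refine integral_nonneg_of_ae (Eventually.of_forall fun ω => mul_nonneg ?_ (hf ω))
    unfold stay
    split_ifs
    exacts [zero_le_one, le_rfl]
  · simp only [hE]
    refine tendsto_integral_of_dominated_convergence (fun _ => C) (fun k => ?_)
      (integrable_const _) (fun k => Eventually.of_forall fun ω => ?_)
      (Eventually.of_forall fun ω => (hfg ω).const_mul _)
    · exact (stay_mul_integrable P ρ (f k) j).aestronglyMeasurable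
    · rw [norm_mul, ← one_mul C]
      exact mul_le_mul (norm_stay_le _ _ _ _) (hC k ω) (norm_nonneg _) zero_le_one

/-- `1_s` as an element of the algebra over `ℤ₊`. -/
def indic (s : Set (ℕ → S)) (hs : MeasurableSet s) : HalfLineAlg S :=
  HalfLineAlg.mk (s.indicator 1) (measurable_one.indicator hs) 1 fun ω => by
    by_cases h : ω ∈ s <;> simp [h]

lemma indic_apply (s : Set (ℕ → S)) (hs : MeasurableSet s) (ω : ℕ → S) :
    indic s hs ω = s.indicator 1 ω := rfl

lemma HalfLineAlg.ext {f g : HalfLineAlg S} (h : ∀ ω, f ω = g ω) : f = g :=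
  Subtype.ext (lp.ext (funext h))

/-- The defining properties determine `E_{0]}`. -/
lemma forwardMap_unique (P : StochasticMatrix S) (ρ : S → ℝ)
    {E F : HalfLineAlg S →ₗ[ℂ] SiteAlg S} (hE : IsForwardMap P ρ E) (hF : IsForwardMap P ρ F) :
    E = F := by
  classical
  have h1 : ∀ s (hs : MeasurableSet s), E (indic s hs) = F (indic s hs) := by
    intro s hs
    induction s, hs using MeasurableSpace.induction_on_inter
      (generateFrom_squareCylinders (α := fun _ : ℕ => S)).symm
      (isPiSystem_squareCylinders (fun _ => MeasurableSpace.isPiSystem_measurableSet)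
        (fun _ => MeasurableSet.univ)) with
    | empty =>
      have : indic (∅ : Set (ℕ → S)) MeasurableSet.empty = 0 :=
        HalfLineAlg.ext fun ω => by rw [indic_apply, Set.indicator_empty]; rfl
      rw [this, map_zero, map_zero]
    | basic t ht =>
      obtain ⟨s, u, _, rfl⟩ := ht
      let a : ℕ → SiteAlg S := fun k =>
        ⟨fun i => if k ∈ s → i ∈ u k then 1 else 0, memℓp_infty ⟨1, by
          rintro _ ⟨i, rfl⟩
          dsimp only
          split_ifs <;> simp⟩⟩
      have ha : ∀ k i, a k i = if k ∈ s → i ∈ u k then 1 else 0 := fun _ _ => rfl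
      have : ∀ h, indic ((s : Set ℕ).pi u) h = tensor a (s.sup id) := by
        intro h
        refine HalfLineAlg.ext fun ω => ?_
        rw [indic_apply, tensor_apply]
        by_cases hω : ω ∈ (s : Set ℕ).pi u
        · rw [Set.indicator_of_mem hω]
          exact (Finset.prod_eq_one fun k _ => by rw [ha]; exact if_pos fun hk => hω k hk).symm
        · rw [Set.indicator_of_notMem hω]
          simp only [Set.mem_pi, not_forall] at hω
          obtain ⟨k, hk, hku⟩ := hω
          refine (Finset.prod_eq_zero (i := k) (Finset.mem_range.2 (Nat.lt_succ_iff.2 ?_)) ?_).symm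
          · exact Finset.le_sup (f := id) (Finset.mem_coe.1 hk)
          · rw [ha, if_neg (fun h => hku (h (Finset.mem_coe.1 hk)))]
      rw [this, hE.map_tensor, hF.map_tensor]
    | compl t htm ih =>
      have hadd : indic tᶜ htm.compl + indic t htm = 1 := by
        refine HalfLineAlg.ext fun ω => ?_
        change tᶜ.indicator 1 ω + t.indicator 1 ω = (1 : ℂ)
        by_cases h : ω ∈ t <;> simp [h]
      have h1 : E 1 = F 1 := by
        have : (1 : HalfLineAlg S) = tensor 1 0 := HalfLineAlg.ext fun ω => by
          rw [tensor_apply, Finset.prod_eq_one]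
          · rfl
          · intro k _; rfl
        rw [this, hE.map_tensor, hF.map_tensor]
      have h2 : E (indic tᶜ htm.compl) + E (indic t htm) =
          F (indic tᶜ htm.compl) + F (indic t htm) := by
        rw [← LinearMap.map_add, ← LinearMap.map_add, hadd, h1]
      rw [ih] at h2
      exact add_right_cancel h2
    | iUnion f hd hfm ih =>
      let g : ℕ → HalfLineAlg S := fun n => ∑ k ∈ Finset.range n, indic (f k) (hfm k)
      have hg : ∀ n ω, g n ω = ∑ k ∈ Finset.range n, (f k).indicator 1 ω := by
        intro n ω
        induction n with
        | zero => rfl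
        | succ n ihn =>
          rw [Finset.sum_range_succ, ← ihn, show g (n + 1) = g n + indic (f n) (hfm n) from
            Finset.sum_range_succ _ _]
          rfl
      have hg2 : ∀ n ω, g n ω = (⋃ k ∈ Finset.range n, f k).indicator 1 ω := by
        intro n ω
        rw [hg, Finset.indicator_biUnion_apply]
        intro i _ k _ hik
        exact hd hik
      have hgE : ∀ n, E (g n) = F (g n) := by
        intro n
        simp only [g, map_sum]
        exact Finset.sum_congr rfl fun k _ => ih k
      have hb : ∀ n ω, ‖g n ω‖ ≤ 1 := by
        intro n ω
        rw [hg2]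
        by_cases h : ω ∈ ⋃ k ∈ Finset.range n, f k
        · rw [Set.indicator_of_mem h]; simp
        · rw [Set.indicator_of_notMem h]; simp
      have hlim : ∀ ω, Tendsto (fun n => g n ω) atTop
          (𝓝 (indic (⋃ k, f k) (MeasurableSet.iUnion hfm) ω)) := by
        intro ω
        simp only [hg2, indic_apply]
        refine tendsto_const_nhds.congr' ?_
        by_cases h : ω ∈ ⋃ k, f k
        · obtain ⟨k, hk⟩ := Set.mem_iUnion.1 h
          filter_upwards [eventually_gt_atTop k] with n hn
          rw [Set.indicator_of_mem h, Set.indicator_of_mem]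
          exact Set.mem_biUnion (Finset.mem_coe.2 (Finset.mem_range.2 hn)) hk
        · refine Eventually.of_forall fun n => ?_
          rw [Set.indicator_of_notMem h]
          refine (Set.indicator_of_notMem (fun h' => ?_) _).symm
          simp only [Set.mem_iUnion] at h' h
          obtain ⟨k, _, hk⟩ := h'
          exact h ⟨k, hk⟩
      refine lp.ext (funext fun j => ?_)
      have t1 := hE.normal g _ 1 hb hlim j
      have t2 := hF.normal g _ 1 hb hlim j
      simp only [hgE] at t1
      exact tendsto_nhds_unique t1 t2
  have h2 : ∀ (g : SimpleFunc (ℕ → S) ℂ) (f : HalfLineAlg S), (∀ ω, f ω = g ω) →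
      E f = F f := by
    intro g f hf
    have : f = ∑ c ∈ g.range, c • indic (g ⁻¹' {c}) (g.measurableSet_fiber c) := by
      refine HalfLineAlg.ext fun ω => ?_
      have hs : ∀ (s : Finset ℂ), (∑ c ∈ s, c • indic (g ⁻¹' {c}) (g.measurableSet_fiber c) :
          HalfLineAlg S) ω = ∑ c ∈ s, c * (g ⁻¹' {c}).indicator 1 ω := by
        intro s
        induction s using Finset.induction_on with
        | empty => rfl
        | insert c s hc ih =>
          rw [Finset.sum_insert hc, Finset.sum_insert hc, ← ih]
          rfl
      rw [hs, hf, Finset.sum_eq_single (g ω)]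
      · rw [Set.indicator_of_mem (by simp)]; simp
      · intro c _ hc
        rw [Set.indicator_of_notMem, mul_zero]
        exact fun h => hc h.symm
      · intro h
        exact absurd (g.mem_range_self ω) h
    rw [this, map_sum, map_sum]
    exact Finset.sum_congr rfl fun c _ => by rw [map_smul, map_smul, h1]
  refine LinearMap.ext fun f => lp.ext (funext fun j => ?_)
  have hsm := (HalfLineAlg.measurable_apply f).stronglyMeasurable
  let g : ℕ → HalfLineAlg S := fun n =>
    HalfLineAlg.mk (hsm.approxBounded ‖f.1‖ n) (SimpleFunc.measurable _) ‖f.1‖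
      fun ω => hsm.norm_approxBounded_le (norm_nonneg _) n ω
  have hlim : ∀ ω, Tendsto (fun n => g n ω) atTop (𝓝 (f ω)) := fun ω =>
    hsm.tendsto_approxBounded_of_norm_le (HalfLineAlg.norm_apply_le f ω)
  have hb : ∀ n ω, ‖g n ω‖ ≤ ‖f.1‖ := fun n ω => hsm.norm_approxBounded_le (norm_nonneg _) n ω
  have t1 := hE.normal g f _ hb hlim j
  have t2 := hF.normal g f _ hb hlim j
  have hg : ∀ n, E (g n) = F (g n) := fun n =>
    h2 (hsm.approxBounded ‖f.1‖ n) (g n) fun _ => rfl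
  simp only [hg] at t1
  exact tendsto_nhds_unique t1 t2

/-- The map `E_{0]}` from the algebra over `ℤ₊` to the one-site algebra: the unique map with the
properties in `IsForwardMap`. -/
def forwardMap (P : StochasticMatrix S) (ρ : S → ℝ) : HalfLineAlg S →ₗ[ℂ] SiteAlg S :=
  Classical.choose (exists_forwardMap P ρ)

lemma forwardMap_spec (P : StochasticMatrix S) (ρ : S → ℝ) :
    IsForwardMap P ρ (forwardMap P ρ) :=
  Classical.choose_spec (exists_forwardMap P ρ)

/-- The functional `φ(a) = ρ⁽⁰⁾(E_{0]}(a))` on the algebra over `ℤ₊`. -/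
def qmcFunctional (P : StochasticMatrix S) (ρ : NormalState S) (a : HalfLineAlg S) : ℂ :=
  ρ.eval (forwardMap P ρ.density a)

/-- `(ρ⁽⁰⁾, (ℰ⁽ⁿ⁾))` is a Markov pair, i.e. `φ(I ⊗ I ⊗ ⋯) = 1`; equivalently, it is a
(nonhomogeneous) quantum Markov chain with initial state `ρ⁽⁰⁾`. -/
def IsMarkovPair (P : StochasticMatrix S) (ρ : NormalState S) : Prop :=
  qmcFunctional P ρ 1 = 1

/-- `p_{[n}` is a reducing projection. -/
def IsReducing (P : StochasticMatrix S) (ρ : NormalState S) (p : SiteAlg S) (n : ℕ) : Prop :=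
  ∀ a : HalfLineAlg S, forwardMap P ρ.density (tailProj p n * a * tailProj p n) =
    forwardMap P ρ.density a

/-- The quantum Markov chain is reducible: there are a nontrivial projection `p` of the one-site
algebra and `n₀` such that `p_{[n₀}` is reducing. -/
def IsReducible (P : StochasticMatrix S) (ρ : NormalState S) : Prop :=
  ∃ (p : SiteAlg S) (n₀ : ℕ), IsStarProjection p ∧ p ≠ 0 ∧ p ≠ 1 ∧ IsReducing P ρ p n₀

/-- `(ρ⁽⁰⁾, (ℰ⁽ⁿ⁾))` is an irreducible quantum Markov chain. -/
def IsIrreducibleQMC (P : StochasticMatrix S) (ρ : NormalState S) : Prop :=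
  IsMarkovPair P ρ ∧ ¬ IsReducible P ρ

end QMC

end ClassicalQMC

end

/-! In an irreducible chain every state `j` has a predecessor, that is, no column of `P` vanishes:
otherwise `j` could not be reached from any other state, while the row at `j` must lead to another
state. Everything rests on this fact (`exists_pred`), which is used in two dual ways.

On measures: a strictly positive `ρ` stays strictly positive under `P` (`evolve_pos`). A faithful
state has strictly positive density, so every support projection equals `I`, and the transition
expectation reduces to `x ⊗ y ↦ x · P y`. Since `P 1 = 1`, all the nested expectations of `I` are
`I`. Hence `b(n) = I` and `E_{0]}(I) = I`, which gives the Markov pair property.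

On observables: `P` sends no nonzero `y ≥ 0` to zero (`exists_act_pos`), so a nonzero `q ≥ 0` placed
at site `n` has a nonzero image under `E_{0]}` (`nest_pos_of_evolve_pos`). If `p` were reducing from
`n` on, put `q = I - p ≠ 0`. The inequality `p_{[n} + J_n(q) ≤ I` and `E_{0]}(p_{[n}) = E_{0]}(I)`
would force `E_{0]}(J_n(q)) ≤ 0`, a contradiction. -/

namespace ClassicalQMC

open scoped ENNReal ComplexOrder Topology
open Filter MeasureTheory ProbabilityTheory

/-! ### Positivity of the evolved distributions and of the transition expectations -/

section Positivity

variable {S : Type*}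

/-- In an irreducible chain every state can be reached in one step from some state. -/
lemma StochasticMatrix.IsIrreducible.exists_pred {P : StochasticMatrix S}
    (hP : P.IsIrreducible) (j : S) : ∃ i, 0 < P i j := by
  by_contra! h
  have hz : ∀ i, P i j = 0 := fun i => le_antisymm (h i) (P.nonneg i j)
  -- The powers are built by splitting off the first step: from `i`, either it goes to `j`, which
  -- has weight zero, or it goes to some `k ≠ j`, where the induction hypothesis applies.
  have hn : ∀ n i, i ≠ j → P.nStep n i j = 0 := by
    intro n
    induction n with
    | zero => intro i hi; simp [StochasticMatrix.nStep, hi]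
    | succ n ih =>
      intro i _
      rw [StochasticMatrix.nStep]
      refine (tsum_congr fun k => ?_).trans tsum_zero
      by_cases hk : k = j
      · rw [hk, hz, zero_mul]
      · rw [ih k hk, mul_zero]
  -- A starting point different from `j` is needed, since `nStep 0 j j = 1`. The row at `j` sums to
  -- one and `P j j = 0`, so it charges some other state; this also excludes a one-point state
  -- space.
  have hrow : ∃ i, P j i ≠ 0 := by
    by_contra! h0
    have := (P.row_sum j).tsum_eq
    simp [h0] at this
  obtain ⟨i, hi⟩ := hrow
  have hij : i ≠ j := fun e => hi (e ▸ hz j)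
  obtain ⟨n, hpos⟩ := (hP i j).1
  exact hpos.ne' (hn n i hij)

lemma StochasticMatrix.evolve_nonneg (P : StochasticMatrix S) {ρ : S → ℝ} (h0 : ∀ j, 0 ≤ ρ j)
    (n : ℕ) (j : S) : 0 ≤ P.evolve ρ n j := by
  induction n generalizing j with
  | zero => exact h0 j
  | succ n ih => exact tsum_nonneg fun k => mul_nonneg (ih k) (P.nonneg k j)

/-- Tonelli for the nonnegative double series: summing over targets first gives back `ρ⁽ⁿ⁾`, because
the rows sum to one. Summability has to be tracked because `tsum` is `0` on divergent series, so
positive terms alone would not make the next distribution positive. -/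
lemma StochasticMatrix.summable_evolve_mul (P : StochasticMatrix S) {ρ : S → ℝ}
    (h0 : ∀ j, 0 ≤ ρ j) (hs : Summable ρ) (n : ℕ) :
    Summable (P.evolve ρ n) ∧ Summable fun x : S × S => P.evolve ρ n x.1 * P x.1 x.2 := by
  have key : ∀ m, Summable (P.evolve ρ m) →
      Summable fun x : S × S => P.evolve ρ m x.1 * P x.1 x.2 := by
    intro m hm
    refine (summable_prod_of_nonneg fun x =>
      mul_nonneg (P.evolve_nonneg h0 m x.1) (P.nonneg _ _)).2 ⟨fun x => ?_, ?_⟩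
    · exact (P.row_sum x).summable.mul_left (P.evolve ρ m x)
    · simpa only [tsum_mul_left, (P.row_sum _).tsum_eq, mul_one] using hm
  suffices h : Summable (P.evolve ρ n) from ⟨h, key n h⟩
  induction n with
  | zero => exact hs
  -- After exchanging the coordinates the inner sum runs over sources, and it is the defining series
  -- of `ρ⁽ⁿ⁺¹⁾`.
  | succ n ih => exact (key n ih).prod_symm.prod

/-- The term of a predecessor `i` of `j` already contributes `ρ⁽ⁿ⁾_i P(i, j) > 0` to the next mass
at `j`. -/
lemma StochasticMatrix.IsIrreducible.evolve_pos {P : StochasticMatrix S} (hP : P.IsIrreducible)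
    {ρ : S → ℝ} (h0 : ∀ j, 0 < ρ j) (hs : Summable ρ) (n : ℕ) (j : S) : 0 < P.evolve ρ n j := by
  induction n generalizing j with
  | zero => exact h0 j
  | succ n ih =>
    obtain ⟨i, hi⟩ := hP.exists_pred j
    have hsum : Summable fun k => P.evolve ρ n k * P k j :=
      (P.summable_evolve_mul (fun k => (h0 k).le) hs n).2.prod_symm.prod_factor j
    exact hsum.tsum_pos (fun k => mul_nonneg (ih k).le (P.nonneg k j)) i (mul_pos (ih i) hi)

lemma siteAlg_one_apply (j : S) : (1 : SiteAlg S) j = 1 := rfl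

lemma supportProj_eq_one {ρ : S → ℝ} (h : ∀ j, 0 < ρ j) : supportProj ρ = 1 := by
  refine lp.ext (funext fun j => ?_)
  change (if 0 < ρ j then 1 else 0 : ℂ) = 1
  rw [if_pos (h j)]

lemma NormalState.IsFaithful.density_pos {ρ : NormalState S} (hρ : ρ.IsFaithful) (j : S) :
    0 < ρ.density j := by
  classical
  refine (ρ.nonneg j).lt_of_ne' fun h => ?_
  -- The test element is the projection onto `j`; writing it as a support projection supplies its
  -- boundedness.
  let x : SiteAlg S := supportProj (Pi.single j 1)
  have hx : ∀ k, x k = if k = j then 1 else 0 := by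
    intro k
    change (if 0 < (Pi.single j 1 : S → ℝ) k then 1 else 0 : ℂ) = _
    by_cases hk : k = j
    · subst hk; simp
    · simp [hk]
  have h1 : x = 0 := by
    refine hρ x ((tsum_congr fun k => ?_).trans tsum_zero)
    rw [lp.infty_coeFn_mul, Pi.mul_apply, hx]
    by_cases hk : k = j
    · rw [hk, h, Complex.ofReal_zero, zero_mul]
    · rw [if_neg hk, mul_zero, mul_zero]
  have h2 := hx j
  rw [h1, if_pos rfl] at h2
  exact zero_ne_one h2

lemma StochasticMatrix.act_one (P : StochasticMatrix S) : P.act 1 = 1 := by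
  refine lp.ext (funext fun j => ?_)
  change ∑' i, (P j i : ℂ) * (1 : SiteAlg S) i = 1
  simp only [siteAlg_one_apply, mul_one]
  rw [← Complex.ofReal_tsum, (P.row_sum j).tsum_eq, Complex.ofReal_one]

lemma StochasticMatrix.act_nonneg (P : StochasticMatrix S) {y : SiteAlg S} (hy : ∀ j, 0 ≤ y j)
    (j : S) : 0 ≤ P.act y j :=
  tsum_nonneg fun i => mul_nonneg (Complex.zero_le_real.2 (P.nonneg j i)) (hy i)

/-- For an irreducible chain `y ↦ P y` maps no nonzero positive observable to zero. -/
lemma StochasticMatrix.IsIrreducible.exists_act_pos {P : StochasticMatrix S}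
    (hP : P.IsIrreducible) {y : SiteAlg S} (hy : ∀ j, 0 ≤ y j) (h : ∃ j, 0 < y j) :
    ∃ j, 0 < P.act y j := by
  obtain ⟨s, hs⟩ := h
  obtain ⟨i, hi⟩ := hP.exists_pred s
  exact ⟨i, (P.summable_mul y i).of_norm.tsum_pos
    (fun k => mul_nonneg (Complex.zero_le_real.2 (P.nonneg i k)) (hy k)) s
    (mul_pos (Complex.zero_lt_real.2 hi) hs)⟩

variable {P : StochasticMatrix S} {ρ : S → ℝ}

/-- All dependence on time and on the initial state sits in the support projections, which are
trivial here. -/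
lemma transExp_of_evolve_pos (hρ : ∀ n j, 0 < P.evolve ρ n j) (n : ℕ) (x y : SiteAlg S) :
    transExp P ρ n x y = x * P.act y := by
  rw [transExp, supportProj_eq_one (hρ n), one_mul]

lemma nest_one_of_evolve_pos (hρ : ∀ n j, 0 < P.evolve ρ n j) (m k : ℕ) :
    nest (transExp P ρ) 1 1 m k = 1 := by
  induction k generalizing m with
  | zero => rw [nest, transExp_of_evolve_pos hρ, P.act_one, Pi.one_apply, one_mul]
  | succ k ih => rw [nest, ih, transExp_of_evolve_pos hρ, P.act_one, Pi.one_apply, one_mul]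

/-- If `q ≥ 0` is nonzero then so is `ℰ⁽ᵐ⁾(I ⊗ ⋯ ⊗ ℰ⁽ᵐ⁺ᵏ⁾(q ⊗ I))`. -/
lemma nest_pos_of_evolve_pos (hP : P.IsIrreducible) (hρ : ∀ n j, 0 < P.evolve ρ n j)
    {a : ℕ → SiteAlg S} {q : SiteAlg S} (hq : ∀ j, 0 ≤ q j) (hq' : ∃ j, 0 < q j) (m k : ℕ)
    (ha : ∀ l, l < m + k → a l = 1) (hak : a (m + k) = q) :
    (∀ j, 0 ≤ nest (transExp P ρ) a 1 m k j) ∧ ∃ j, 0 < nest (transExp P ρ) a 1 m k j := by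
  induction k generalizing m with
  | zero =>
    rw [add_zero] at hak
    rw [nest, hak, transExp_of_evolve_pos hρ, P.act_one, mul_one]
    exact ⟨hq, hq'⟩
  | succ k ih =>
    -- The induction moves the outermost time `m` up while the site `m + k` carrying `q` stays
    -- fixed.
    obtain ⟨h1, h2⟩ := ih (m + 1) (fun l hl => ha l (by omega))
      (by rw [← hak]; congr 1; omega)
    rw [nest, ha m (by omega), transExp_of_evolve_pos hρ, one_mul]
    exact ⟨P.act_nonneg h1, hP.exists_act_pos h1 h2⟩

end Positivity

/-! ### The forward map: normalization and absence of reducing projections -/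

section QMC

variable {S : Type*} [MeasurableSpace S] [DiscreteMeasurableSpace S]
  {P : StochasticMatrix S}

/-- The sequence defining the limit is constantly `I`. -/
lemma bbar_of_evolve_pos {ρ : S → ℝ} (hρ : ∀ n j, 0 < P.evolve ρ n j) (n : ℕ) :
    bbar P ρ n = 1 := by
  refine lp.ext (funext fun j => tendsto_nhds_unique (bbar_spec P ρ n j) ?_)
  simp only [nest_one_of_evolve_pos hρ]
  exact tendsto_const_nhds

lemma tensor_one : tensor (1 : ℕ → SiteAlg S) 0 = 1 := by
  refine HalfLineAlg.ext fun ω => ?_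
  rw [tensor_apply, Finset.prod_eq_one]
  · rfl
  · intro k _; rfl

lemma forwardMap_one_of_evolve_pos {ρ : S → ℝ} (hρ : ∀ n j, 0 < P.evolve ρ n j) :
    forwardMap P ρ 1 = 1 := by
  rw [← tensor_one, (forwardMap_spec P ρ).map_tensor, bbar_of_evolve_pos hρ,
    nest_one_of_evolve_pos hρ]

lemma isMarkovPair_of_evolve_pos {ρ : NormalState S}
    (hρ : ∀ n j, 0 < P.evolve ρ.density n j) : IsMarkovPair P ρ := by
  rw [IsMarkovPair, qmcFunctional, forwardMap_one_of_evolve_pos hρ, NormalState.eval]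
  simp only [siteAlg_one_apply, mul_one]
  rw [← Complex.ofReal_tsum, ρ.sum_one.tsum_eq, Complex.ofReal_one]

/-- Reduction by `p_{[n}` would make the event of being outside `p` at time `n` null from every
starting state, whereas irreducibility gives it positive weight from some starting state. -/
lemma not_isReducible_of_evolve_pos (hP : P.IsIrreducible) {ρ : NormalState S}
    (hρ : ∀ n j, 0 < P.evolve ρ.density n j) : ¬ IsReducible P ρ := by
  classical
  rintro ⟨p, n, hp, -, hp1, hred⟩
  let q : SiteAlg S := 1 - p
  have hq : ∀ j, q j = 1 - p j := fun _ => rfl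
  have hq0 : ∀ j, 0 ≤ q j := by
    intro j
    rcases proj_zero_or_one hp j with h | h <;> simp [hq, h]
  have hqpos : ∃ j, 0 < q j := by
    by_contra! hcon
    refine hp1 (lp.ext (funext fun j => ?_))
    rcases proj_zero_or_one hp j with h | h
    · exact absurd (by simp [hq, h]) (hcon j)
    · exact h
  -- `tensor a n` is `J_n(q)`: its last factor is the only nontrivial one.
  let a : ℕ → SiteAlg S := fun l => if l = n then q else 1
  have han : a n = q := if_pos rfl
  have ha : ∀ l, l ≠ n → a l = 1 := fun l hl => if_neg hl
  have htensor : ∀ ω, tensor a n ω = q (ω n) := by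
    intro ω
    rw [tensor_apply, Finset.prod_range_succ, Finset.prod_eq_one, one_mul, han]
    intro l hl
    rw [ha l (Finset.mem_range.1 hl).ne]
    rfl
  obtain ⟨j, hj⟩ := (nest_pos_of_evolve_pos hP hρ hq0 hqpos 0 n
    (fun l hl => ha l (by omega)) (by rw [zero_add, han])).2
  -- The innermost `I` of the nested expectation is read as `b(n+1)`, so that the positive value is
  -- a value of `E_{0]}`.
  rw [← bbar_of_evolve_pos hρ (n + 1), ← (forwardMap_spec P ρ.density).map_tensor] at hj
  -- `p_{[n} ≤ I ⊗ ⋯ ⊗ p ⊗ I ⊗ ⋯`, so the tensor with `1 - p` at `n` is at most `1 - p_{[n}`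
  have hle := (forwardMap_spec P ρ.density).nonneg
    (1 + (-1 : ℂ) • (tailProj p n * 1 * tailProj p n + tensor a n)) (fun ω => by
      change 0 ≤ 1 + (-1 : ℂ) * ((tailProj p n * 1 * tailProj p n : HalfLineAlg S) ω + tensor a n ω)
      rw [htensor, HalfLineAlg.mul_apply, mul_one]
      have ht : tailProj p n ω = if ∀ k, n ≤ k → p (ω k) = 1 then 1 else 0 := rfl
      rw [ht, hq]
      -- On a path that stays in `p` from `n` on, the condition at time `n` itself gives `q(ω_n) =
      -- 0`; on any other path `p_{[n}` vanishes and `q ≤ 1` suffices.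
      split_ifs with h
      · simp [h n le_rfl]
      · rcases proj_zero_or_one hp (ω n) with h0 | h0 <;> simp [h0]) j
  -- Only the instance `a = I` of the reducing property is needed: the two copies of `E_{0]}(I)`
  -- cancel and leave `0 ≤ -E_{0]}(J_n(q))` at `j`.
  rw [LinearMap.map_add, LinearMap.map_smul, LinearMap.map_add, hred 1, smul_add, neg_one_smul,
    neg_one_smul, add_neg_cancel_left] at hle
  change 0 ≤ -(forwardMap P ρ.density (tensor a n) j) at hle
  exact absurd (neg_nonneg.1 hle) hj.not_ge

end QMC

end ClassicalQMC

theorem mainTheorem9 {S : Type*} [Countable S] [MeasurableSpace S] [DiscreteMeasurableSpace S]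
    (P : ClassicalQMC.StochasticMatrix S) (hP : P.IsIrreducible)
    (ρ : ClassicalQMC.NormalState S) (hρ : ρ.IsFaithful) :
    ClassicalQMC.IsIrreducibleQMC P ρ := by
  have hpos := hP.evolve_pos hρ.density_pos ρ.sum_one.summable
  exact ⟨ClassicalQMC.isMarkovPair_of_evolve_pos hpos,
    ClassicalQMC.not_isReducible_of_evolve_pos hP hpos⟩
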